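/- For a free (non-principal) ultrafilter $p$ on $\omega$ and a sequence $(x_n)_{n\in\omega}$ in a topological space $X$, a point $x\in X$ is a $p$-limit of $(x_n)$ if $\{n\in\omega : x_n\in U\}\in p$ for every neighbourhood $U$ of $x$. The ultrafilter $p$ is selective if it is free and, for every partition $\{A_n : n\in\omega\}$ of $\omega$ into nonempty pairwise disjoint sets, either $A_n\in p$ for some $n$, or there is $B\in p$ with $|B\cap A_n|=1$ for all $n$. A space $X$ is selectively $p$-pseudocompact if for every sequence $(U_n)_{n\in\omega}$ of nonempty open subsets of $X$ there are points $x_n\in U_n$ ($n\in\omega$) such that $(x_n)$ has a $p$-limit in $X$; it is selectively pseudocompact if for every such sequence $(U_n)$ there are points $x_n\in U_n$ and a free ultrafilter $q$ on $\omega$ (which may depend on $(U_n)$) such that $(x_n)$ has a $q$-limit in $X$. Finally, $X$ is countably pracompact if it has a dense subset $D$ such that every infinite subset of $D$ has an accumulation point in $X$. **Theorem.** 1. For every free ultrafilter $p$ on $\omega$, the product of any family of selectively $p$-pseudocompact topological spaces is selectively $p$-pseudocompact. 2. If $p$ is a selective ultrafilter on $\omega$, then there exists a Hausdorff Boolean topological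 group $G$ (that is, every $g\in G$ satisfies $g+g=0$) which is selectively $p$-pseudocompact but not countably pracompact. Moreover, for every index set $I$, the power $G^I$ is selectively $p$-pseudocompact, and hence selectively pseudocompact. -/

import Mathlib

open Filter Topology

universe u v

/-- `p` is a free (non-principal) ultrafilter on `ω`, i.e. `p ∈ ω*`. -/
def IsFreeUltrafilter (p : Ultrafilter ℕ) : Prop :=
  ∀ n : ℕ, p ≠ pure n

/-- `p` is a selective ultrafilter: it is free, and for every partition `{A n : n ∈ ω}` of `ω`
(into nonempty pairwise disjoint sets), either some `A n` belongs to `p`, or some `B ∈ p` meets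
every `A n` in exactly one point. -/
def IsSelectiveUltrafilter (p : Ultrafilter ℕ) : Prop :=
  IsFreeUltrafilter p ∧
    ∀ A : ℕ → Set ℕ, (∀ n, (A n).Nonempty) → (∀ m n, m ≠ n → Disjoint (A m) (A n)) →
      (⋃ n, A n) = Set.univ →
        (∃ n, A n ∈ p) ∨ ∃ B ∈ p, ∀ n, ∃! k, k ∈ B ∩ A n

/-- `a` is a `p`-limit of the sequence `x`: `{n | x n ∈ U} ∈ p` for every neighbourhood `U`
of `a`. -/
def IsUltrafilterLimit {X : Type*} [TopologicalSpace X] (p : Ultrafilter ℕ) (x : ℕ → X)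
    (a : X) : Prop :=
  ∀ U ∈ 𝓝 a, {n : ℕ | x n ∈ U} ∈ p

/-- `X` is selectively `p`-pseudocompact. -/
def SelectivelyUltraPseudocompact (p : Ultrafilter ℕ) (X : Type*) [TopologicalSpace X] : Prop :=
  ∀ U : ℕ → Set X, (∀ n, IsOpen (U n)) → (∀ n, (U n).Nonempty) →
    ∃ (x : ℕ → X) (a : X), (∀ n, x n ∈ U n) ∧ IsUltrafilterLimit p x a

/-- `X` is selectively pseudocompact; here the free ultrafilter may depend on the sequence of
open sets. -/
def SelectivelyPseudocompact (X : Type*) [TopologicalSpace X] : Prop :=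
  ∀ U : ℕ → Set X, (∀ n, IsOpen (U n)) → (∀ n, (U n).Nonempty) →
    ∃ (x : ℕ → X) (a : X) (p : Ultrafilter ℕ), IsFreeUltrafilter p ∧
      (∀ n, x n ∈ U n) ∧ IsUltrafilterLimit p x a

/-- `X` is countably pracompact: there is a dense set `D` such that every infinite subset of `D`
has an accumulation point in `X`. -/
def CountablyPracompact (X : Type*) [TopologicalSpace X] : Prop :=
  ∃ D : Set X, Dense D ∧ ∀ S : Set X, S ⊆ D → S.Infinite → ∃ a : X, AccPt a (𝓟 S)

/-!
The product statement holds because a sequence in a product has a `p`-limit as soon as each of its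
coordinates has one: a sequence of open sets is shrunk to basic boxes, and selections are made in
each factor separately, which is possible because `p` does not vary.

The group lives in the power `A → ZMod 2` with `A` of size continuum. There are continuum many
sequences of basic open sets; the `ξ`-th of them receives a block of generators `(ξ, some n)`,
the `n`-th lying in the `n`-th set, and a generator `(ξ, none)` which is their `p`-limit. The
subgroup `limitGroup` they generate is selectively `p`-pseudocompact by construction. A basic open
set constrains only finitely many coordinates, so on any countable family of blocks all but
countably many coordinates are free, up to the requirement of respecting `p`-limits, and can be
used to separate a sequence from a point.

The failure of countable pracompactness comes from the fact that every infinite subset of the group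
contains an infinite set without accumulation points
(`exists_infinite_subset_forall_not_accPt`). To see this, an injective sequence in the free Boolean
group on the generators is thinned to a triangular one, whose `n`-th term contains a generator
absent from all earlier terms. Since `p` is free and an infinite set has an infinite subset outside
`p`, a further thinning makes the triangular shape compatible with `p`-limits
(`exists_triangular_rank`). Then for every `g` a homomorphism respecting `p`-limits can be defined
recursively so that it vanishes at `g` and is `1` on almost all terms
(`exists_subseq_forall_exists_respectsLimits`). There are only continuum many pairs of a sequence
and a point, so such homomorphisms can be used as coordinates of the group, each one continuum
often, and they witness that no point of the group is an accumulation point of the thinned sequence.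
This uses only that the selective ultrafilter `p` is free.
-/

/-! ### Free ultrafilters on `ℕ` -/

theorem IsFreeUltrafilter.le_cofinite {p : Ultrafilter ℕ} (hp : IsFreeUltrafilter p) :
    (p : Filter ℕ) ≤ cofinite := by
  rcases p.le_cofinite_or_eq_pure with h | ⟨a, h⟩
  · exact h
  · exact absurd h (hp a)

theorem IsFreeUltrafilter.infinite_of_mem {p : Ultrafilter ℕ} (hp : IsFreeUltrafilter p)
    {s : Set ℕ} (hs : s ∈ p) : s.Infinite := fun hfin =>
  p.compl_mem_iff_notMem.1 (hp.le_cofinite hfin.compl_mem_cofinite) hs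

/-- An infinite set splits into two infinite halves, and an ultrafilter contains at most one of
them. -/
theorem Ultrafilter.exists_infinite_subset_notMem (p : Ultrafilter ℕ) {s : Set ℕ}
    (hs : s.Infinite) : ∃ t ⊆ s, t.Infinite ∧ t ∉ p := by
  obtain ⟨t, w, rfl, hd, hc⟩ := hs.exists_union_disjoint_cardinal_eq_of_infinite
  have hiff : t.Infinite ↔ w.Infinite := by
    rw [← Set.infinite_coe_iff, ← Set.infinite_coe_iff, Cardinal.infinite_iff,
      Cardinal.infinite_iff, hc]
  have hboth : t.Infinite ∧ w.Infinite := by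
    rcases Set.infinite_union.1 hs with h | h
    · exact ⟨h, hiff.1 h⟩
    · exact ⟨hiff.2 h, h⟩
  by_cases ht : t ∈ p
  · exact ⟨w, Set.subset_union_right, hboth.2, fun hw =>
      p.empty_notMem (hd.inter_eq ▸ p.inter_sets ht hw)⟩
  · exact ⟨t, Set.subset_union_left, hboth.1, ht⟩

/-! ### Triangular subsequences in a free Boolean group -/

theorem ZMod.finsupp_ext_support {E : Type*} {v w : E →₀ ZMod 2} (h : v.support = w.support) :
    v = w := by
  ext e
  have key : ∀ a b : ZMod 2, (a ≠ 0 ↔ b ≠ 0) → a = b := by decide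
  exact key _ _ (by rw [← Finsupp.mem_support_iff, h, Finsupp.mem_support_iff])

theorem exists_triangular_subseq {E : Type*} {h : ℕ → E →₀ ZMod 2}
    (hinj : Function.Injective h) :
    ∃ (σ : ℕ → ℕ) (ε : ℕ → E), StrictMono σ ∧
      ∀ n, ε n ∈ (h (σ n)).support ∧ ∀ k < n, ε n ∉ (h (σ k)).support := by
  classical
  obtain ⟨f, hf, hlt⟩ := exists_seq_of_forall_finset_exists
    (fun x : ℕ × E => x.2 ∈ (h x.1).support)
    (fun x y => x.1 < y.1 ∧ y.2 ∉ (h x.1).support) (by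
      intro s _
      -- Only finitely many group elements are supported in a given finite set.
      set F : Finset E := s.biUnion fun x => (h x.1).support
      have hfin : {n | (h n).support ⊆ F}.Finite := by
        refine Set.Finite.of_finite_image (f := fun n => (h n).support)
          (F.powerset.finite_toSet.subset ?_) ?_
        · rintro _ ⟨n, hn, rfl⟩
          simpa using hn
        · intro a _ b _ hab
          exact hinj (ZMod.finsupp_ext_support hab)
      obtain ⟨n, hn⟩ :=
        (hfin.union (Set.finite_Iic ((s.image Prod.fst).sup id))).infinite_compl.nonempty
      simp only [Set.mem_compl_iff, Set.mem_union, Set.mem_ofPred_eq, Set.mem_Iic, not_or,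
        not_le] at hn
      obtain ⟨e, he, heF⟩ := Finset.not_subset.1 hn.1
      refine ⟨(n, e), he, fun x hx => ⟨lt_of_le_of_lt ?_ hn.2, fun hxe => heF ?_⟩⟩
      · exact Finset.le_sup (f := id) (Finset.mem_image_of_mem Prod.fst hx)
      · exact Finset.mem_biUnion.2 ⟨x, hx, hxe⟩)
  exact ⟨fun n => (f n).1, fun n => (f n).2, fun a b hab => (hlt a b hab).1,
    fun n => ⟨hf n, fun k hk => (hlt k n hk).2⟩⟩

/-- The distinguished coordinates of a triangular sequence can be thinned out so that either all
of them are limit coordinates, or none is and each block meets them in a set outside `p`. -/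
theorem exists_thin_subseq {K : Type*} {p : Ultrafilter ℕ} (hp : IsFreeUltrafilter p)
    {ε : ℕ → K × Option ℕ} :
    ∃ τ : ℕ → ℕ, StrictMono τ ∧ ((∀ n, (ε (τ n)).2 = none) ∨
      ((∀ n ξ, ε (τ n) ≠ (ξ, none)) ∧
        ∀ ξ, ∀ᶠ m in (p : Filter ℕ), ∀ n, ε (τ n) ≠ (ξ, some m))) := by
  by_cases hfr : ∃ᶠ n in atTop, (ε n).2 = none
  · obtain ⟨τ, hτ, h⟩ := extraction_of_frequently_atTop hfr
    exact ⟨τ, hτ, Or.inl h⟩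
  have hev : ∀ᶠ n in atTop, (ε n).2 ≠ none := not_frequently.1 hfr
  obtain ⟨N, hN⟩ := eventually_atTop.1 hev
  by_cases hbig : ∃ ξ, {m | ∃ n ≥ N, ε n = (ξ, some m)} ∈ p
  · -- One block already contains `p`-many of the coordinates: keep an infinite part of it.
    obtain ⟨ξ, hξ⟩ := hbig
    obtain ⟨t, hts, htinf, htp⟩ := p.exists_infinite_subset_notMem (hp.infinite_of_mem hξ)
    have hfreq : ∃ᶠ n in atTop, ∃ m ∈ t, ε n = (ξ, some m) := by
      rw [Nat.frequently_atTop_iff_infinite]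
      intro hfin
      refine htinf ((hfin.image fun n => ((ε n).2.getD 0)).subset fun m hm => ?_)
      obtain ⟨n, -, hn⟩ := hts hm
      exact ⟨n, ⟨m, hm, hn⟩, by simp [hn]⟩
    obtain ⟨τ, hτ, h⟩ := extraction_of_frequently_atTop hfreq
    refine ⟨τ, hτ, Or.inr ⟨fun n ξ' he => ?_, fun ξ' => ?_⟩⟩
    · obtain ⟨m, -, hm⟩ := h n
      simp [hm] at he
    · filter_upwards [p.compl_mem_iff_notMem.2 htp] with m hm n he
      obtain ⟨m', hm', hm2⟩ := h n
      rw [hm2] at he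
      simp only [Prod.mk.injEq, Option.some.injEq] at he
      exact hm (he.2 ▸ hm')
  · push Not at hbig
    refine ⟨fun n => n + N, fun a b hab => by simpa using hab, Or.inr ⟨fun n ξ he => ?_,
      fun ξ => ?_⟩⟩
    · exact hN (n + N) (by omega) (by rw [he])
    · filter_upwards [p.compl_mem_iff_notMem.2 (hbig ξ)] with m hm n he
      exact hm ⟨n + N, by omega, he⟩

/-- `F` respects limits if, on every block, its value at the limit coordinate `(ξ, none)` is the
`p`-limit of its values at the coordinates `(ξ, some m)`. -/
def RespectsLimits {K Y : Type*} (p : Ultrafilter ℕ) (F : K × Option ℕ → Y) : Prop :=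
  ∀ ξ, ∀ᶠ m in (p : Filter ℕ), F (ξ, some m) = F (ξ, none)

/-- Every injective sequence has a subsequence on which some limit-respecting rank of coordinates
is in triangular form: in the `n`-th term a single coordinate has rank `n + 1`, all others have
smaller rank. Rank `0` stands for the coordinates that play no role. -/
theorem exists_triangular_rank {K : Type*} {p : Ultrafilter ℕ} (hp : IsFreeUltrafilter p)
    {h : ℕ → K × Option ℕ →₀ ZMod 2} (hinj : Function.Injective h) :
    ∃ (σ : ℕ → ℕ) (r : K × Option ℕ → ℕ), StrictMono σ ∧ RespectsLimits p r ∧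
      ∀ n, ∃ e₀ ∈ (h (σ n)).support, r e₀ = n + 1 ∧
        ∀ e ∈ (h (σ n)).support, e ≠ e₀ → r e ≤ n := by
  classical
  obtain ⟨σ, ε', hσ, hε'⟩ := exists_triangular_subseq hinj
  obtain ⟨τ, hτ, hcase⟩ := exists_thin_subseq hp (ε := ε')
  set ε := fun n => ε' (τ n) with hεdef
  set w := fun n => (h (σ (τ n))).support with hw
  have hmem : ∀ n, ε n ∈ w n := fun n => (hε' (τ n)).1
  have hnot : ∀ n, ∀ k < n, ε n ∉ w k := fun n k hk => (hε' (τ n)).2 _ (hτ hk)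
  have hεinj : Function.Injective ε := by
    intro a b hab
    rcases lt_trichotomy a b with hlt | heq | hlt
    · exact absurd (hab ▸ hmem a) (hnot b a hlt)
    · exact heq
    · exact absurd (hab ▸ hmem b) (hnot a b hlt)
  have hle : ∀ n k, ε k ∈ w n → k ≤ n := fun n k hk => not_lt.1 fun hlt => hnot k n hlt hk
  -- `q e = n + 1` if `e = ε n`, and `q e = 0` off the range of `ε`
  obtain ⟨q, hq, hq0⟩ : ∃ q : K × Option ℕ → ℕ, (∀ n, q (ε n) = n + 1) ∧
      ∀ e, (∀ n, ε n ≠ e) → q e = 0 :=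
    ⟨Function.extend ε (fun n => n + 1) (fun _ => 0), fun n => hεinj.extend_apply _ _ n,
      fun e he => Function.extend_apply' _ _ _ fun ⟨n, hn⟩ => he n hn⟩
  have hqcases : ∀ e, q e = 0 ∨ ∃ n, ε n = e ∧ q e = n + 1 := by
    intro e
    by_cases he : ∃ n, ε n = e
    · obtain ⟨n, rfl⟩ := he
      exact Or.inr ⟨n, rfl, hq n⟩
    · exact Or.inl (hq0 e (not_exists.1 he))
  rcases hcase with hnone | ⟨hsome, hsmall⟩
  · -- Rank `(ξ, some m)` like `(ξ, none)`, except for the finitely many `m` occurring early on.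
    refine ⟨σ ∘ τ, fun e => if e.2 ≠ none ∧ ∃ k < q (e.1, none), e ∈ w k then 0
      else q (e.1, none), hσ.comp hτ, fun ξ => ?_, fun n => ?_⟩
    · have hfin : {m : ℕ | ∃ k < q (ξ, none), (ξ, some m) ∈ w k}.Finite := by
        have : {m : ℕ | ∃ k < q (ξ, none), (ξ, some m) ∈ w k} ⊆
            (fun m => ((ξ, some m) : K × Option ℕ)) ⁻¹'
              (((Finset.range (q (ξ, none))).biUnion w : Finset (K × Option ℕ)) : Set _) := by
          rintro m ⟨k, hk, hm⟩
          simp only [Set.mem_preimage, Finset.mem_coe, Finset.mem_biUnion, Finset.mem_range]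
          exact ⟨k, hk, hm⟩
        refine Set.Finite.subset (Set.Finite.preimage ?_ (Finset.finite_toSet _)) this
        intro a _ b _ hab
        simpa using hab
      filter_upwards [hp.le_cofinite hfin.compl_mem_cofinite] with m hm
      have hm' : ¬ ∃ k < q (ξ, none), (ξ, some m) ∈ w k := hm
      simp only [ne_eq, reduceCtorEq, not_false_eq_true, true_and, not_true_eq_false, false_and,
        if_false, if_neg hm']
    · have hεn : ∀ k, ((ε k).1, none) = ε k := fun k => Prod.ext rfl (hnone k).symm
      refine ⟨ε n, hmem n, ?_, fun e he hne => ?_⟩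
      · dsimp only
        rw [if_neg (fun hc => hc.1 (hnone n)), hεn, hq]
      · dsimp only
        split_ifs with hc
        · exact Nat.zero_le _
        · rcases hqcases (e.1, none) with h0 | ⟨k, hk, hk'⟩
          · omega
          · rw [hk']
            by_contra hgt
            by_cases h2 : e.2 = none
            · have hke : ε k = e := by rw [hk, ← h2]
              have h1 := hle n k (hke ▸ he)
              have h2 : k ≠ n := fun hkn => hne (by rw [← hke, hkn])
              omega
            · exact hc ⟨h2, n, by omega, he⟩
  · refine ⟨σ ∘ τ, q, hσ.comp hτ, fun ξ => ?_, fun n => ⟨ε n, hmem n, hq n, fun e he hne => ?_⟩⟩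
    · filter_upwards [hsmall ξ] with m hm
      rw [hq0 _ hm, hq0 _ fun n => hsome n ξ]
    · rcases hqcases e with h0 | ⟨k, rfl, hk'⟩
      · omega
      · have h1 := hle n k he
        have h2 : k ≠ n := fun hkn => hne (by rw [hkn])
        omega

/-! ### Homomorphisms that separate a sequence from a point -/

/-- The homomorphism given on coordinates by `F` takes, on almost all terms of the sequence `h`, a
value other than its value at `g`; with values in `ℤ/2` this says that it is eventually `1` on
`h n + g`. -/
def SeparatesEventually {E : Type*} (F : E → ZMod 2) (h : ℕ → E →₀ ZMod 2) (g : E →₀ ZMod 2) :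
    Prop :=
  ∀ᶠ n in atTop, Finsupp.linearCombination (ZMod 2) F (h n + g) = 1

/-- Recursive definition of a sequence whose `n`-th term depends on the smaller ones. -/
theorem exists_eq_of_depends_on_smaller {Y : Type*} [Inhabited Y] (Φ : ℕ → (ℕ → Y) → Y)
    (hΦ : ∀ n c c', (∀ k < n, c k = c' k) → Φ n c = Φ n c') : ∃ c : ℕ → Y, ∀ n, c n = Φ n c := by
  classical
  let c : ℕ → Y := Nat.lt_wfRel.wf.fix fun n ih =>
    Φ n fun k => if hk : k < n then ih k hk else default
  refine ⟨c, fun n => ?_⟩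
  have : c n = Φ n fun k => if k < n then c k else default := by
    change Nat.lt_wfRel.wf.fix _ n = _
    rw [WellFounded.fix_eq]
    rfl
  rw [this]
  exact hΦ _ _ _ fun k hk => by simp [hk]

/-- Every injective sequence has a subsequence `h ∘ σ` that can be separated from each `g` by a
limit-respecting homomorphism.
The homomorphism is `c ∘ r` on coordinates, with `r` a triangular rank; `c` vanishes on the ranks
occurring in `g`, and its later values are chosen recursively, the `n`-th term fixing
`c (n + 1)`. -/
theorem exists_subseq_forall_exists_respectsLimits {K : Type*} {p : Ultrafilter ℕ}
    (hp : IsFreeUltrafilter p) {h : ℕ → K × Option ℕ →₀ ZMod 2} (hinj : Function.Injective h) :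
    ∃ σ : ℕ → ℕ, StrictMono σ ∧ ∀ g : K × Option ℕ →₀ ZMod 2,
      ∃ F : K × Option ℕ → ZMod 2, RespectsLimits p F ∧
        SeparatesEventually F (h ∘ σ) g := by
  classical
  obtain ⟨σ, r, hσ, hr, htri⟩ := exists_triangular_rank hp hinj
  choose e₀ he₀ hre₀ hre using htri
  refine ⟨σ, hσ, fun g => ?_⟩
  set N := g.support.sup r
  obtain ⟨c, hc⟩ := exists_eq_of_depends_on_smaller
    (fun n (c : ℕ → ZMod 2) => if n ≤ N then 0 else
      1 + ∑ e ∈ (h (σ (n - 1))).support.erase (e₀ (n - 1)), c (r e)) (by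
      intro n c c' hcc
      split_ifs with hn
      · rfl
      · refine congrArg _ (Finset.sum_congr rfl fun e he => hcc _ ?_)
        have := hre (n - 1) e (Finset.mem_of_mem_erase he) (Finset.ne_of_mem_erase he)
        omega)
  have hlin : ∀ v : K × Option ℕ →₀ ZMod 2,
      Finsupp.linearCombination (ZMod 2) (c ∘ r) v = ∑ e ∈ v.support, c (r e) := by
    intro v
    rw [Finsupp.linearCombination_apply, Finsupp.sum]
    refine Finset.sum_congr rfl fun e he => ?_
    have key : ∀ a : ZMod 2, a ≠ 0 → a = 1 := by decide
    rw [key _ (Finsupp.mem_support_iff.1 he), one_smul, Function.comp]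
  refine ⟨c ∘ r, fun ξ => (hr ξ).mono fun m hm => congrArg c hm, ?_⟩
  filter_upwards [eventually_ge_atTop N] with n hn
  have hg : ∑ e ∈ g.support, c (r e) = 0 := Finset.sum_eq_zero fun e he => by
    rw [hc, if_pos (Finset.le_sup he)]
  rw [Function.comp_apply, map_add, hlin, hlin, hg, add_zero, ← Finset.add_sum_erase _ _ (he₀ n),
    hre₀, hc (n + 1), if_neg (by omega), Nat.add_sub_cancel, add_assoc, CharTwo.add_self_eq_zero, add_zero]

/-! ### Products of selectively `p`-pseudocompact spaces -/

/-- A basic open box inside each open set reduces the claim to the factors, where limits may be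
found independently because `p` is fixed. -/
theorem SelectivelyUltraPseudocompact.pi {p : Ultrafilter ℕ} {ι : Type u} {X : ι → Type v}
    [∀ i, TopologicalSpace (X i)] (hX : ∀ i, SelectivelyUltraPseudocompact p (X i)) :
    SelectivelyUltraPseudocompact p (∀ i, X i) := by
  classical
  intro U hUo hUne
  choose y hy using hUne
  choose I V hV hVU using fun n => isOpen_pi_iff.1 (hUo n) (y n) (hy n)
  have hcoord : ∀ i, ∃ (x : ℕ → X i) (a : X i),
      (∀ n, x n ∈ if i ∈ I n then V n i else Set.univ) ∧ IsUltrafilterLimit p x a := by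
    refine fun i => hX i _ (fun n => ?_) fun n => ⟨y n i, ?_⟩
    · split_ifs with hi
      · exact (hV n i hi).1
      · exact isOpen_univ
    · split_ifs with hi
      · exact (hV n i hi).2
      · trivial
  choose x a hx ha using hcoord
  refine ⟨fun n i => x i n, a, fun n => hVU n fun i hi => ?_, ?_⟩
  · simpa only [if_pos (Finset.mem_coe.1 hi)] using hx i n
  · have : Tendsto (fun n i => x i n) (p : Filter ℕ) (𝓝 a) := tendsto_pi_nhds.2 fun i => ha i
    exact fun W hW => this hW

theorem SelectivelyUltraPseudocompact.selectivelyPseudocompact {p : Ultrafilter ℕ}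
    (hp : IsFreeUltrafilter p) {X : Type*} [TopologicalSpace X]
    (hX : SelectivelyUltraPseudocompact p X) : SelectivelyPseudocompact X := fun U hUo hUne =>
  let ⟨x, a, hx, ha⟩ := hX U hUo hUne
  ⟨x, a, p, hp, hx, ha⟩

/-! ### A group of limits inside a power of `ℤ/2` -/

section LimitGroup

variable {A : Type} (p : Ultrafilter ℕ) (S : A → ℕ → Finset A × Finset A)
  (F : A → A × Option ℕ → ZMod 2)

/-- The `α`-th coordinate of the generators. For `S ξ n = (D, T)`, the generator `(ξ, some n)` is
required to lie in the basic open set of those `z : A → ZMod 2` which on `D` agree with the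
indicator function of `T`; if `α ∉ D` its coordinate is free, and is read off from `F α`. The
generator `(ξ, none)` is the `p`-limit of the generators `(ξ, some n)`. -/
noncomputable def generatorCoord (α : A) : A × Option ℕ → ZMod 2 :=
  open Classical in
  let f : A → ℕ → ZMod 2 := fun ξ n =>
    if α ∈ (S ξ n).1 then (if α ∈ (S ξ n).2 then 1 else 0) else F α (ξ, some n)
  fun e => match e with
    | (ξ, some n) => f ξ n
    | (ξ, none) => if {n | f ξ n = 1} ∈ p then 1 else 0

variable {S F} in
theorem generatorCoord_of_mem {α ξ : A} {n : ℕ} (h : α ∈ (S ξ n).1) [Decidable (α ∈ (S ξ n).2)] :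
    generatorCoord p S F α (ξ, some n) = if α ∈ (S ξ n).2 then 1 else 0 := by
  simp [generatorCoord, h]

variable {S F} in
theorem generatorCoord_of_notMem {α ξ : A} {n : ℕ} (h : α ∉ (S ξ n).1) :
    generatorCoord p S F α (ξ, some n) = F α (ξ, some n) := by
  simp [generatorCoord, h]

theorem respectsLimits_generatorCoord (α : A) : RespectsLimits p (generatorCoord p S F α) := by
  intro ξ
  have key : ∀ a : ZMod 2, a ≠ 1 → a = 0 := by decide
  by_cases h : {n | generatorCoord p S F α (ξ, some n) = 1} ∈ p
  · have h1 : generatorCoord p S F α (ξ, none) = 1 := if_pos h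
    filter_upwards [h] with n hn
    rw [h1]
    exact hn
  · have h1 : generatorCoord p S F α (ξ, none) = 0 := if_neg h
    filter_upwards [p.compl_mem_iff_notMem.2 h] with n hn
    rw [h1]
    exact key _ hn

variable {p S F} in
/-- On a block where the `α`-th coordinate is unconstrained, it is `F α`. -/
theorem generatorCoord_eq_of_free {α : A} (hF : RespectsLimits p (F α)) {e : A × Option ℕ}
    (h : ∀ n, α ∉ (S e.1 n).1) : generatorCoord p S F α e = F α e := by
  obtain ⟨ξ, _ | n⟩ := e
  · obtain ⟨n, h1, h2⟩ := ((respectsLimits_generatorCoord p S F α ξ).and (hF ξ)).exists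
    rw [← h1, ← h2, generatorCoord_of_notMem p (h n)]
  · exact generatorCoord_of_notMem p (h n)

/-- The homomorphism from the free Boolean group on the generators to `A → ZMod 2` with
coordinates `generatorCoord`. -/
noncomputable def generatorHom : (A × Option ℕ →₀ ZMod 2) →ₗ[ZMod 2] (A → ZMod 2) :=
  LinearMap.pi fun α => Finsupp.linearCombination (ZMod 2) (generatorCoord p S F α)

theorem generatorHom_apply (v : A × Option ℕ →₀ ZMod 2) (α : A) :
    generatorHom p S F v α = Finsupp.linearCombination (ZMod 2) (generatorCoord p S F α) v := rfl

theorem generatorHom_single (e : A × Option ℕ) (α : A) :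
    generatorHom p S F (Finsupp.single e 1) α = generatorCoord p S F α e := by
  simp [generatorHom_apply]

/-- The topological group generated by the images of the generators in `A → ZMod 2`. -/
noncomputable abbrev limitGroup : AddSubgroup (A → ZMod 2) :=
  (generatorHom p S F).toAddMonoidHom.range

/-- The image of `v` in the group. -/
noncomputable def limitGroup.mk (v : A × Option ℕ →₀ ZMod 2) : limitGroup p S F :=
  ⟨generatorHom p S F v, v, rfl⟩

theorem limitGroup.exists_mk_eq (x : limitGroup p S F) : ∃ v, limitGroup.mk p S F v = x := by
  obtain ⟨_, v, rfl⟩ := x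
  exact ⟨v, rfl⟩

/-- If every sequence of basic open sets is listed by `S`, the generators are the required
selections. -/
theorem selectivelyUltraPseudocompact_limitGroup (hS : Function.Surjective S) :
    SelectivelyUltraPseudocompact p (limitGroup p S F) := by
  classical
  intro U hUo hUne
  choose y hy using hUne
  have hbox : ∀ n, ∃ I : Finset A, ∀ z : limitGroup p S F,
      (∀ α ∈ I, z.1 α = (y n).1 α) → z ∈ U n := by
    intro n
    obtain ⟨W, hWo, hW⟩ := isOpen_induced_iff.1 (hUo n)
    have hyW : (y n).1 ∈ W := by
      have := hy n
      rwa [← hW] at this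
    obtain ⟨I, V, hV, hVW⟩ := isOpen_pi_iff.1 hWo _ hyW
    refine ⟨I, fun z hz => ?_⟩
    rw [← hW]
    exact hVW fun α hα => by rw [hz α hα]; exact (hV α hα).2
  choose I hI using hbox
  obtain ⟨ξ, hξ⟩ := hS fun n => (I n, (I n).filter fun α => (y n).1 α = 1)
  refine ⟨fun n => limitGroup.mk p S F (Finsupp.single (ξ, some n) 1),
    limitGroup.mk p S F (Finsupp.single (ξ, none) 1), fun n => hI n _ fun α hα => ?_, ?_⟩
  · have hmem : α ∈ (S ξ n).1 := by rw [hξ]; exact hα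
    have key : ∀ a : ZMod 2, (if a = 1 then 1 else 0) = a := by decide
    change generatorHom p S F _ α = _
    rw [generatorHom_single, generatorCoord_of_mem p hmem, ← key ((y n).1 α), hξ]
    simp [hα]
  · have : Tendsto (fun n => limitGroup.mk p S F (Finsupp.single (ξ, some n) 1)) (p : Filter ℕ)
        (𝓝 (limitGroup.mk p S F (Finsupp.single (ξ, none) 1))) := by
      rw [tendsto_subtype_rng, tendsto_pi_nhds]
      intro α
      refine tendsto_nhds_of_eventually_eq ?_
      filter_upwards [respectsLimits_generatorCoord p S F α ξ] with n hn
      change generatorHom p S F _ α = generatorHom p S F _ α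
      rw [generatorHom_single, generatorHom_single, hn]
    exact fun W hW => this hW

/-- For an injective sequence `j` of coordinates, a block is chosen whose `n`-th generator has
coordinates `0` at `j k` for `k < n` and `1` at `j n`; its generators are then distinct. -/
theorem infinite_limitGroup [Infinite A] (hS : Function.Surjective S) :
    Infinite (limitGroup p S F) := by
  classical
  let j := Infinite.natEmbedding A
  obtain ⟨ξ, hξ⟩ := hS fun n => ((Finset.range (n + 1)).map j, {j n})
  have hval : ∀ k n, k ≤ n →
      (limitGroup.mk p S F (Finsupp.single (ξ, some n) 1)).1 (j k) = if k = n then 1 else 0 := by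
    intro k n hkn
    have hmem : j k ∈ (S ξ n).1 := by
      rw [hξ]
      exact Finset.mem_map_of_mem j (by simpa [Nat.lt_succ_iff] using hkn)
    change generatorHom p S F _ _ = _
    rw [generatorHom_single, generatorCoord_of_mem p hmem, hξ]
    simp
  refine Infinite.of_injective (fun n => limitGroup.mk p S F (Finsupp.single (ξ, some n) 1)) ?_
  have hne : ∀ k n, k < n → limitGroup.mk p S F (Finsupp.single (ξ, some k) 1) ≠
      limitGroup.mk p S F (Finsupp.single (ξ, some n) 1) := by
    intro k n hkn heq
    have h1 := hval k k le_rfl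
    rw [heq, hval k n hkn.le, if_neg hkn.ne, if_pos rfl] at h1
    exact zero_ne_one h1
  intro k n hkn
  rcases lt_trichotomy k n with hlt | heq | hlt
  · exact absurd hkn (hne k n hlt)
  · exact heq
  · exact absurd hkn.symm (hne n k hlt)

/-- A choice of free values for which each pair of a sequence and a point that can be separated by
a limit-respecting homomorphism is separated by uncountably many `F α`, hence by a coordinate of
the group. -/
def FreeValuesSeparate : Prop :=
  (∀ α, RespectsLimits p (F α)) ∧
    ∀ (h : ℕ → A × Option ℕ →₀ ZMod 2) (g : A × Option ℕ →₀ ZMod 2),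
      (∃ F₀, RespectsLimits p F₀ ∧ SeparatesEventually F₀ h g) →
        ¬ {α | SeparatesEventually (F α) h g}.Countable

variable {p F} in
/-- Only countably many coordinates are constrained on the countably many blocks met by a sequence
and a point, so an unconstrained coordinate separates them. -/
theorem exists_coord_separating (hF : FreeValuesSeparate p F)
    {h : ℕ → A × Option ℕ →₀ ZMod 2} {g : A × Option ℕ →₀ ZMod 2}
    (hsep : ∃ F₀, RespectsLimits p F₀ ∧ SeparatesEventually F₀ h g) :
    ∃ α, ∀ᶠ n in atTop, generatorHom p S F (h n) α ≠ generatorHom p S F g α := by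
  classical
  have hcount : {α | ∃ n, ∃ e ∈ (h n + g).support, ∃ m, α ∈ (S e.1 m).1}.Countable := by
    have : {α | ∃ n, ∃ e ∈ (h n + g).support, ∃ m, α ∈ (S e.1 m).1} =
        ⋃ n, ⋃ e ∈ (h n + g).support, ⋃ m, ((S e.1 m).1 : Set A) := by
      ext α
      simp
    rw [this]
    exact Set.countable_iUnion fun n => (Finset.countable_toSet _).biUnion fun e _ =>
      Set.countable_iUnion fun m => Finset.countable_toSet _
  obtain ⟨α, hα, hfree⟩ := Set.not_subset.1 fun hsub => hF.2 h g hsep (hcount.mono hsub)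
  refine ⟨α, hα.mono fun n hn heq => ?_⟩
  have hval : generatorHom p S F (h n + g) α = 1 := by
    rw [generatorHom_apply, ← hn, Finsupp.linearCombination_apply, Finsupp.linearCombination_apply]
    refine Finsupp.sum_congr fun e he => ?_
    rw [generatorCoord_eq_of_free (hF.1 α) fun m hm => hfree ⟨n, e, he, m, hm⟩]
  rw [map_add, Pi.add_apply, heq, CharTwo.add_self_eq_zero] at hval
  exact zero_ne_one hval

variable {p F} in
/-- Every infinite subset of the group contains an infinite set without accumulation points. -/
theorem exists_infinite_subset_forall_not_accPt (hp : IsFreeUltrafilter p)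
    (hF : FreeValuesSeparate p F) {D : Set (limitGroup p S F)} (hD : D.Infinite) :
    ∃ T ⊆ D, T.Infinite ∧ ∀ a, ¬ AccPt a (𝓟 T) := by
  let x := hD.natEmbedding
  choose h hh using fun n => limitGroup.exists_mk_eq p S F (x n).1
  have hinj : Function.Injective h := fun a b hab =>
    x.injective (Subtype.ext (by rw [← hh, ← hh, hab]))
  obtain ⟨σ, hσ, hsep⟩ := exists_subseq_forall_exists_respectsLimits hp hinj
  have hxinj : Function.Injective fun n => (x (σ n)).1 :=
    Subtype.val_injective.comp (x.injective.comp hσ.injective)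
  refine ⟨Set.range fun n => (x (σ n)).1, ?_, Set.infinite_range_of_injective hxinj, fun a => ?_⟩
  · rintro _ ⟨n, rfl⟩
    exact (x (σ n)).2
  obtain ⟨g, rfl⟩ := limitGroup.exists_mk_eq p S F a
  obtain ⟨α, hα⟩ := exists_coord_separating S hF (hsep g)
  obtain ⟨N, hN⟩ := eventually_atTop.1 hα
  set a := limitGroup.mk p S F g
  rw [accPt_iff_frequently, not_frequently]
  have hnhds : ∀ᶠ y in 𝓝 a, y.1 α = a.1 α :=
    ((continuous_apply α).comp continuous_subtype_val).continuousAt.eventually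
      ((isOpen_discrete {a.1 α}).mem_nhds rfl)
  -- The finitely many terms not covered by the coordinate `α` form a closed set.
  have hfin : ∀ᶠ y in 𝓝 a, y ∉ ((fun n => (x (σ n)).1) '' Set.Iio N) \ {a} :=
    ((Set.finite_Iio N).image _).sdiff.isClosed.isOpen_compl.mem_nhds (fun hc => hc.2 rfl)
  filter_upwards [hnhds, hfin] with y hy1 hy2
  rintro ⟨hya, n, rfl⟩
  refine hy2 ⟨⟨n, Set.mem_Iio.2 (not_le.1 fun hn => hN n hn ?_), rfl⟩, hya⟩
  simp only [← hh] at hy1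
  exact hy1

variable {p F} in
theorem not_countablyPracompact_limitGroup [Infinite A] (hp : IsFreeUltrafilter p)
    (hS : Function.Surjective S) (hF : FreeValuesSeparate p F) :
    ¬ CountablyPracompact (limitGroup p S F) := by
  rintro ⟨D, hD, hacc⟩
  have := infinite_limitGroup p S F hS
  have hDinf : D.Infinite := fun hfin => Set.infinite_univ (α := limitGroup p S F) <| by
    rw [← hD.closure_eq, hfin.isClosed.closure_eq]
    exact hfin
  obtain ⟨T, hTD, hT, hno⟩ := exists_infinite_subset_forall_not_accPt S hp hF hDinf
  obtain ⟨a, ha⟩ := hacc T hTD hT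
  exact hno a ha

end LimitGroup

/-! ### Indexing by the continuum -/

open Cardinal in
/-- Each of the continuum many sequences of basic open sets gets a block. -/
theorem exists_surjective_listing_boxes :
    ∃ S : Set ℕ → ℕ → Finset (Set ℕ) × Finset (Set ℕ), Function.Surjective S := by
  have : #(Set ℕ) = #(ℕ → Finset (Set ℕ) × Finset (Set ℕ)) := by
    simp [mk_finset_of_infinite]
  obtain ⟨e⟩ := Cardinal.eq.1 this
  exact ⟨e, e.surjective⟩

open Cardinal in
/-- Each of the continuum many pairs of a sequence and a point is attached to continuum many
coordinates. -/
theorem exists_freeValuesSeparate (p : Ultrafilter ℕ) :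
    ∃ F : Set ℕ → Set ℕ × Option ℕ → ZMod 2, FreeValuesSeparate p F := by
  classical
  let V := Set ℕ × Option ℕ →₀ ZMod 2
  have hcard : #(Set ℕ) = #(((ℕ → V) × V) × Set ℕ) := by
    have hV : #V = 𝔠 := by simpa [V] using (nat_lt_continuum 2).le
    simp [hV]
  obtain ⟨R⟩ := Cardinal.eq.1 hcard
  have hchoice : ∀ hg : (ℕ → V) × V, ∃ F : Set ℕ × Option ℕ → ZMod 2, RespectsLimits p F ∧
      ((∃ F₀, RespectsLimits p F₀ ∧ SeparatesEventually F₀ hg.1 hg.2) →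
        SeparatesEventually F hg.1 hg.2) := by
    intro hg
    by_cases hex : ∃ F₀, RespectsLimits p F₀ ∧ SeparatesEventually F₀ hg.1 hg.2
    · obtain ⟨F₀, h1, h2⟩ := hex
      exact ⟨F₀, h1, fun _ => h2⟩
    · exact ⟨fun _ => 0, fun ξ => Eventually.of_forall fun _ => rfl, fun hc => absurd hc hex⟩
  choose Φ hΦ hΦsep using hchoice
  refine ⟨fun α => Φ (R α).1, fun α => hΦ _, fun h g hsep hcount => ?_⟩
  have hpre := hcount.preimage (f := fun t : Set ℕ => R.symm ((h, g), t))
    fun s t hst => by simpa using hst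
  have huniv : (Set.univ : Set (Set ℕ)).Countable := hpre.mono fun t _ => by
    simpa using hΦsep (h, g) hsep
  have hle := Cardinal.le_aleph0_iff_set_countable.2 huniv
  rw [Cardinal.mk_univ] at hle
  simp only [mk_set, mk_nat] at hle
  exact absurd hle (not_le.2 (cantor _))

theorem mainTheorem4 :
    (∀ p : Ultrafilter ℕ, IsFreeUltrafilter p →
      ∀ (ι : Type u) (X : ι → Type v) [∀ i, TopologicalSpace (X i)],
        (∀ i, SelectivelyUltraPseudocompact p (X i)) →
          SelectivelyUltraPseudocompact p (∀ i, X i)) ∧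
    (∀ p : Ultrafilter ℕ, IsSelectiveUltrafilter p →
      ∃ (G : Type) (_ : AddCommGroup G) (_ : TopologicalSpace G),
        IsTopologicalAddGroup G ∧ T2Space G ∧ (∀ g : G, g + g = 0) ∧
        SelectivelyUltraPseudocompact p G ∧
        ¬ CountablyPracompact G ∧
        ∀ ι : Type u, SelectivelyUltraPseudocompact p (ι → G) ∧
          SelectivelyPseudocompact (ι → G)) := by
  refine ⟨fun p _ ι X _ hX => SelectivelyUltraPseudocompact.pi hX, fun p hsel => ?_⟩
  have hp : IsFreeUltrafilter p := hsel.1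
  obtain ⟨S, hS⟩ := exists_surjective_listing_boxes
  obtain ⟨F, hF⟩ := exists_freeValuesSeparate p
  have hG := selectivelyUltraPseudocompact_limitGroup p S F hS
  refine ⟨limitGroup p S F, inferInstance, inferInstance, inferInstance, inferInstance,
    fun g => Subtype.ext (funext fun α => CharTwo.add_self_eq_zero _), hG,
    not_countablyPracompact_limitGroup S hp hS hF, fun ι => ?_⟩
  have hpow : SelectivelyUltraPseudocompact p (ι → limitGroup p S F) :=
    SelectivelyUltraPseudocompact.pi fun _ => hG
  exact ⟨hpow, hpow.selectivelyPseudocompact hp⟩
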